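/- Let $\mathbb{A}$ be a (skew) field, let $\sigma$ be an automorphism of $\mathbb{A}$, and let $\mathbb{A}[x;\sigma]$ be the Ore polynomial ring, with multiplication determined by $xa=\sigma(a)x$ for all $a\in\mathbb{A}$. Let $\mathbb{S}=\mathbb{A}(x;\sigma)$ be the skew field of left fractions of $\mathbb{A}[x;\sigma]$, and for $s\in\mathbb{S}^\times$ let $[s]$ be the class of $s$ in $\mathbb{S}^\times/[\mathbb{S}^\times,\mathbb{S}^\times]$; put $[0]=0$. The Dieudonné determinant $\mathcal{D}et(M)$ of a matrix $M\in\mathbb{S}^{n\times n}$ is $0$ if $M$ is not invertible; if $M$ is invertible, it is the class $[\operatorname{sign}(p)\,d_1\cdots d_n]$, for any reduction of $M$, by elementary row operations (adding a left multiple of one row to another row), to a product $PD$ of the matrix $P$ of a permutation $p$ and an invertible diagonal matrix $D=\operatorname{diag}(d_1,\dots,d_n)$; this class does not depend on the reduction. Then for every $n\times n$ matrix $A$ with entries in $\mathbb{A}[x;\sigma]$ that is invertible over $\mathbb{S}$, the Dieudonné determinant of $A$ is represented by an Ore polynomial that is unique modulo commutators: there is a nonzero $f\in\mathbb{A}[x;\sigma]$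 with $$\mathcal{D}et(A)=[f],$$ and an Ore polynomial $g\in\mathbb{A}[x;\sigma]$ satisfies $\mathcal{D}et(A)=[g]$ if and only if $g=uf$ for some $u$ in the commutator subgroup $[\mathbb{S}^\times,\mathbb{S}^\times]$. -/

import Mathlib

noncomputable section

/-! ### The Ore polynomial ring `A[x; σ]` -/

/-- A copy of the skew field `A`, on which `x ^ k` acts as the `k`-th iterate of `σ`. -/
def OreCoeff {A : Type*} [DivisionRing A] (_σ : A ≃+* A) : Type _ := A

instance OreCoeff.instDivisionRing {A : Type*} [DivisionRing A] (σ : A ≃+* A) :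
    DivisionRing (OreCoeff σ) :=
  inferInstanceAs (DivisionRing A)

instance OreCoeff.instMulSemiringAction {A : Type*} [DivisionRing A] (σ : A ≃+* A) :
    MulSemiringAction (Multiplicative ℕ) (OreCoeff σ) where
  smul k a := (fun b : A => σ b)^[k.toAdd] a
  one_smul _ := rfl
  mul_smul k l a := Function.iterate_add_apply (fun b : A => σ b) k.toAdd l.toAdd a
  smul_zero k := Function.iterate_fixed (f := fun b : A => σ b) (map_zero σ) k.toAdd
  smul_one k := Function.iterate_fixed (f := fun b : A => σ b) (map_one σ) k.toAdd
  smul_add k a b := iterate_map_add σ k.toAdd a b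
  smul_mul k a b := iterate_map_mul σ k.toAdd a b

/-- The Ore polynomial ring `A[x; σ]`: polynomials `∑ aᵢ xⁱ` with left coefficients in `A`,
multiplied according to `x a = σ(a) x`. -/
abbrev OrePoly {A : Type*} [DivisionRing A] (σ : A ≃+* A) : Type _ :=
  SkewPolynomial (OreCoeff σ)

/-- The coefficient copy is `A` itself. -/
def OreCoeff.of {A : Type*} [DivisionRing A] (σ : A ≃+* A) : A ≃+* OreCoeff σ :=
  RingEquiv.refl A

/-- The commutation rule `x a = σ(a) x`. -/
theorem OrePoly.X_mul_C {A : Type*} [DivisionRing A] (σ : A ≃+* A) (a : A) :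
    (SkewPolynomial.X * SkewPolynomial.C (OreCoeff.of σ a) : OrePoly σ)
      = SkewPolynomial.C (OreCoeff.of σ (σ a)) * SkewPolynomial.X := by
  rw [SkewPolynomial.C_mul_X_eq_monomial, ← SkewPolynomial.monomial_zero_left,
    SkewPolynomial.X_mul_monomial]
  rfl

/-! ### Its skew field of left fractions

The Ore localization at the nonzero elements needs that there are no zero divisors and that any two
nonzero polynomials have a common left multiple. -/

namespace SkewPolynomial

theorem exists_lead {K : Type*} [DivisionRing K] {f : SkewPolynomial K} (hf : f ≠ 0) :
    ∃ m, f.coeff m ≠ 0 ∧ ∀ k, m < k → f.coeff k = 0 := by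
  have hne : f.support.Nonempty := by
    rw [Finset.nonempty_iff_ne_empty]
    simpa using hf
  refine ⟨f.support.max' hne, mem_support_iff.1 (f.support.max'_mem hne), fun k hk => ?_⟩
  by_contra h
  exact absurd (f.support.le_max' k (mem_support_iff.2 h)) (not_le.2 hk)

variable {K : Type*} [DivisionRing K] [MulSemiringAction (Multiplicative ℕ) K]

theorem coeff_mul_nat (f g : SkewPolynomial K) (n : ℕ) :
    (f * g).coeff n
      = ∑ p ∈ Finset.HasAntidiagonal.antidiagonal n, f.coeff p.1 * φ^[p.1] (g.coeff p.2) := by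
  classical
  have h := SkewMonoidAlgebra.coeff_mul_antidiagonal_of_finset f g (Multiplicative.ofAdd n)
    ((Finset.HasAntidiagonal.antidiagonal n).map
      ⟨fun p : ℕ × ℕ => ((Multiplicative.ofAdd p.1, Multiplicative.ofAdd p.2) :
        Multiplicative ℕ × Multiplicative ℕ), fun _ _ h => h⟩)
    (by
      rintro ⟨a, b⟩
      simp only [Finset.mem_map, Finset.HasAntidiagonal.mem_antidiagonal]
      constructor
      · rintro ⟨⟨c, d⟩, h, e⟩
        cases e
        rw [← ofAdd_add, h]
      · intro h
        exact ⟨(a.toAdd, b.toAdd), h, rfl⟩)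
  rw [Finset.sum_map] at h
  simp only [φ_iterate_apply]
  exact h

theorem coeff_mul_lead {f g : SkewPolynomial K} {n m : ℕ}
    (hf : ∀ k, n < k → f.coeff k = 0) (hg : ∀ k, m < k → g.coeff k = 0) :
    (f * g).coeff (n + m) = f.coeff n * φ^[n] (g.coeff m) := by
  rw [coeff_mul_nat, Finset.sum_eq_single (n, m)]
  · rintro ⟨a, b⟩ hab hne
    rw [Finset.HasAntidiagonal.mem_antidiagonal] at hab
    dsimp only at hab ⊢
    rcases lt_trichotomy a n with h | h | h
    · rw [hg b (by omega), φ_iterate_apply, smul_zero, mul_zero]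
    · subst h
      exact absurd (by rw [show b = m by omega]) hne
    · rw [hf a h, zero_mul]
  · intro h
    exact absurd (Finset.HasAntidiagonal.mem_antidiagonal.2 (rfl : n + m = n + m)) h

theorem coeff_mul_high {f g : SkewPolynomial K} {n m : ℕ}
    (hf : ∀ k, n < k → f.coeff k = 0) (hg : ∀ k, m < k → g.coeff k = 0)
    {k : ℕ} (hk : n + m < k) : (f * g).coeff k = 0 := by
  rw [coeff_mul_nat]
  refine Finset.sum_eq_zero ?_
  rintro ⟨a, b⟩ hab
  rw [Finset.HasAntidiagonal.mem_antidiagonal] at hab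
  dsimp only at hab ⊢
  rcases le_or_gt a n with h | h
  · rw [hg b (by omega), φ_iterate_apply, smul_zero, mul_zero]
  · rw [hf a h, zero_mul]

theorem iterate_phi_ne_zero (n : ℕ) {a : K} (ha : a ≠ 0) : φ^[n] a ≠ 0 := by
  induction n with
  | zero => exact ha
  | succ n ih =>
    rw [Function.iterate_succ_apply']
    exact (map_ne_zero _).2 ih

instance instNoZeroDivisors : NoZeroDivisors (SkewPolynomial K) where
  eq_zero_or_eq_zero_of_mul_eq_zero {f g} h := by
    by_contra! hfg
    obtain ⟨n, hn, hn'⟩ := exists_lead hfg.1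
    obtain ⟨m, hm, hm'⟩ := exists_lead hfg.2
    have := coeff_mul_lead hn' hm'
    rw [h, coeff_zero] at this
    exact mul_ne_zero hn (iterate_phi_ne_zero n hm) this.symm

/-- Division with remainder on the left: `f = q g + r` with `deg r < deg g`. -/
theorem exists_div {g : SkewPolynomial K} {m : ℕ} (hg : g.coeff m ≠ 0)
    (hg' : ∀ k, m < k → g.coeff k = 0) (N : ℕ) (f : SkewPolynomial K)
    (hf : ∀ k, N ≤ k → f.coeff k = 0) :
    ∃ q r, f = q * g + r ∧ ∀ k, m ≤ k → r.coeff k = 0 := by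
  induction N generalizing f with
  | zero => exact ⟨0, f, by simp, fun k _ => hf k (Nat.zero_le k)⟩
  | succ N ih =>
    by_cases hN : N < m
    · exact ⟨0, f, by simp, fun k hk => hf k (by omega)⟩
    push Not at hN
    let c : K := f.coeff N * (φ^[N - m] (g.coeff m))⁻¹
    have hc : ∀ k, N - m < k → (monomial (N - m) c).coeff k = 0 := fun k hk => by
      rw [coeff_monomial, if_neg (by omega)]
    have hlead := coeff_mul_lead hc hg'
    rw [coeff_monomial, if_pos rfl, inv_mul_cancel_right₀ (iterate_phi_ne_zero _ hg),
      Nat.sub_add_cancel hN] at hlead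
    have hsub : ∀ k, (f - monomial (N - m) c * g).coeff k
        = f.coeff k - (monomial (N - m) c * g).coeff k := fun k => by
      simp [SkewPolynomial.coeff, SkewMonoidAlgebra.coeff_sub]
    obtain ⟨q, r, h, hr⟩ := ih (f - monomial (N - m) c * g) (fun k hk => by
      rw [hsub]
      rcases Nat.eq_or_lt_of_le hk with rfl | hk
      · rw [hlead, sub_self]
      · rw [hf k hk, coeff_mul_high hc hg' (by omega), sub_zero])
    refine ⟨monomial (N - m) c + q, r, ?_, hr⟩
    rw [add_mul, add_assoc, ← h, add_sub_cancel]

theorem exists_common_left_multiple (N : ℕ) (f g : SkewPolynomial K) (hg : g ≠ 0)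
    (hN : ∀ k, N ≤ k → g.coeff k = 0) :
    ∃ q p : SkewPolynomial K, p ≠ 0 ∧ p * f = q * g := by
  induction N generalizing f g with
  | zero => exact absurd (SkewPolynomial.ext fun k => hN k (Nat.zero_le k)) hg
  | succ N ih =>
    obtain ⟨m, hm, hm'⟩ := exists_lead hg
    have hmN : m ≤ N := by
      by_contra h
      exact hm (hN m (by omega))
    obtain ⟨M, hM⟩ : ∃ M, ∀ k, M ≤ k → f.coeff k = 0 := by
      by_cases hf : f = 0
      · exact ⟨0, fun k _ => by rw [hf, coeff_zero]⟩
      · obtain ⟨M, -, hM⟩ := exists_lead hf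
        exact ⟨M + 1, fun k hk => hM k (by omega)⟩
    obtain ⟨q, r, h, hr⟩ := exists_div hm hm' M f hM
    by_cases hr0 : r = 0
    · exact ⟨q, 1, one_ne_zero, by rw [h, hr0, add_zero, one_mul]⟩
    obtain ⟨b, a, ha, hab⟩ := ih g r hr0 (fun k hk => hr k (by omega))
    refine ⟨b * q + a, b, ?_, ?_⟩
    · rintro rfl
      rw [zero_mul] at hab
      exact (mul_ne_zero ha hg) hab
    · rw [h, mul_add, add_mul, mul_assoc, hab]

theorem left_ore (f : SkewPolynomial K) (s : nonZeroDivisors (SkewPolynomial K)) :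
    ∃ (q : SkewPolynomial K) (p : nonZeroDivisors (SkewPolynomial K)),
      (p : SkewPolynomial K) * f = q * s := by
  have hs : (s : SkewPolynomial K) ≠ 0 := nonZeroDivisors.ne_zero s.2
  obtain ⟨m, -, hm⟩ := exists_lead hs
  obtain ⟨q, p, hp, h⟩ := exists_common_left_multiple (m + 1) f s hs (fun k hk => hm k (by omega))
  exact ⟨q, ⟨p, mem_nonZeroDivisors_of_ne_zero hp⟩, h⟩

instance instOreSet : OreLocalization.OreSet (nonZeroDivisors (SkewPolynomial K)) :=
  Classical.choice (OreLocalization.nonempty_oreSet_iff_of_noZeroDivisors.2 left_ore)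

end SkewPolynomial

/-- The skew field `A(x; σ)` of left fractions `g⁻¹ f` of Ore polynomials. -/
abbrev OreFrac {A : Type*} [DivisionRing A] (σ : A ≃+* A) : Type _ :=
  OreLocalization (nonZeroDivisors (OrePoly σ)) (OrePoly σ)

/-- The embedding `A[x; σ] → A(x; σ)`. -/
abbrev OrePoly.toFrac {A : Type*} [DivisionRing A] (σ : A ≃+* A) : OrePoly σ →+* OreFrac σ :=
  OreLocalization.numeratorRingHom

theorem OrePoly.toFrac_injective {A : Type*} [DivisionRing A] (σ : A ≃+* A) :
    Function.Injective (OrePoly.toFrac σ) :=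
  OreLocalization.numeratorHom_inj inf_le_left

/-! ### The Dieudonné determinant over a skew field -/

/-- The products of the elementary matrices `1 + q eᵢⱼ` with `i ≠ j` (a group, since
`1 + q eᵢⱼ` has the inverse `1 - q eᵢⱼ`). -/
def elementaryMatrices (n : ℕ) (S : Type*) [DivisionRing S] :
    Submonoid (Matrix (Fin n) (Fin n) S) :=
  Submonoid.closure {E | ∃ (i j : Fin n) (q : S), i ≠ j ∧ E = 1 + Matrix.single i j q}

/-- The class of `s` in `Sˣ / [Sˣ, Sˣ]`, with a zero adjoined: `[0] = 0`. -/
def commutatorClass {S : Type*} [DivisionRing S] (s : S) : WithZero (Abelianization Sˣ) :=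
  open Classical in
  if h : s = 0 then 0 else ((Abelianization.of (Units.mk0 s h) : Abelianization Sˣ) :
    WithZero (Abelianization Sˣ))

/-- `c` is obtained as a Dieudonné determinant of `M`: either `M` is singular and `c = 0`, or
elementary row operations take `M` to `P D`, where `P` is the matrix of a permutation `p` and `D` is
an invertible diagonal matrix with diagonal `d`, and `c = [sign(p) d₁ ⋯ dₙ]`. -/
def IsDieudonneDet {n : ℕ} {S : Type*} [DivisionRing S] (M : Matrix (Fin n) (Fin n) S)
    (c : WithZero (Abelianization Sˣ)) : Prop :=
  (¬ IsUnit M ∧ c = 0) ∨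
    ∃ E ∈ elementaryMatrices n S, ∃ (p : Equiv.Perm (Fin n)) (d : Fin n → Sˣ),
      E * M = p.permMatrix S * Matrix.diagonal (fun i => (d i : S)) ∧
      c = commutatorClass (((Equiv.Perm.sign p : ℤ) : S) * (List.ofFn fun i => (d i : S)).prod)

/-- The Dieudonné determinant `Det(M)`, the value that all reductions of `M` have in common. (It
always exists; if it did not, the value here would be `0`, also for an invertible `M`.) -/
def dieudonneDet {n : ℕ} {S : Type*} [DivisionRing S] (M : Matrix (Fin n) (Fin n) S) :
    WithZero (Abelianization Sˣ) :=
  open Classical in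
  if h : ∃! c, IsDieudonneDet M c then h.choose else 0

end

open Matrix

/-! Two independent facts are combined. The first is Dieudonné's theorem that the class does not
depend on the reduction. It suffices to exhibit one function `F` on matrices with independent rows
that satisfies `F 1 = 1` and is multiplied by `[c i]` when row `i` is replaced by a combination of
rows with coefficient `c i ≠ 0` at row `i`. Such an `F` is invariant under elementary operations and
is forced on `P D`, so every reduction yields `F A` (`IsRowDet.eq_of_isDieudonneDet`). It is built
by induction on the size (`exists_isRowDet`). In the commutative case the first row `l` of the
inverse satisfies `det A = ± minor / l i`, the minor being that of row `i` and the first column. The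
right-hand side still makes sense modulo commutators, and it does not depend on the row chosen
(`expansion_eq`).

The second fact is that `A[x; σ]` has left division with remainder. The Euclidean algorithm on rows
makes the matrix triangular without leaving the ring (`exists_triangular`). Clearing the entries
above the diagonal needs fractions but leaves the diagonal unchanged (`exists_diagonal`). Hence the
determinant is the class of a product of Ore polynomials. The uniqueness of `f` is then the
definition of equality in the abelianization. -/

/-- `commutatorClass` as a homomorphism of monoids with zero. -/
noncomputable def commutatorClassHom (S : Type*) [DivisionRing S] :
    S →*₀ WithZero (Abelianization Sˣ) where
  toFun := commutatorClass
  map_zero' := by simp [commutatorClass]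
  map_one' := by
    have : Units.mk0 (1 : S) one_ne_zero = 1 := by ext; rfl
    simp [commutatorClass, this]
  map_mul' a b := by
    by_cases ha : a = 0
    · simp [commutatorClass, ha]
    by_cases hb : b = 0
    · simp [commutatorClass, hb]
    have : Units.mk0 (a * b) (mul_ne_zero ha hb) = Units.mk0 a ha * Units.mk0 b hb := by
      ext; rfl
    simp only [commutatorClass, ha, hb, mul_eq_zero, or_self, dite_false, this, map_mul,
      WithZero.coe_mul]

/-! ### Row determinants: the axioms determine the value on every reduction. -/

namespace DieudonneDet

variable {S : Type*} [DivisionRing S]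

/-- The rows of `A` are left linearly independent. -/
def RowIndep {n : ℕ} (A : Matrix (Fin n) (Fin n) S) : Prop :=
  ∀ v, v ᵥ* A = 0 → v = 0

theorem rowIndep_of_isUnit {n : ℕ} {A : Matrix (Fin n) (Fin n) S} (hA : IsUnit A) :
    RowIndep A := by
  obtain ⟨u, rfl⟩ := hA
  intro v hv
  have : v ᵥ* (u : Matrix (Fin n) (Fin n) S) ᵥ* (↑u⁻¹ : Matrix (Fin n) (Fin n) S) = 0 := by
    rw [hv, zero_vecMul]
  rwa [vecMul_vecMul, Units.mul_inv, vecMul_one] at this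

theorem RowIndep.vecMul_injective {n : ℕ} {A : Matrix (Fin n) (Fin n) S} (hA : RowIndep A)
    {v w : Fin n → S} (h : v ᵥ* A = w ᵥ* A) : v = w := by
  rw [← sub_eq_zero]
  apply hA
  rw [sub_vecMul, h, sub_self]

theorem RowIndep.exists_vecMul_eq {n : ℕ} {A : Matrix (Fin n) (Fin n) S} (hA : RowIndep A)
    (w : Fin n → S) : ∃ v, v ᵥ* A = w := by
  have hinj : Function.Injective (vecMulLinear A) := fun v w h => hA.vecMul_injective h
  exact LinearMap.injective_iff_surjective.1 hinj w

theorem vecMul_updateRow {m n : ℕ} (A : Matrix (Fin m) (Fin n) S) (i : Fin m) (r : Fin n → S)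
    (v : Fin m → S) :
    v ᵥ* A.updateRow i r = Function.update v i 0 ᵥ* A + v i • r := by
  ext j
  simp only [vecMul, dotProduct, Pi.add_apply, Pi.smul_apply, smul_eq_mul]
  rw [← Finset.add_sum_erase _ _ (Finset.mem_univ i),
    ← Finset.add_sum_erase _ (fun k => Function.update v i 0 k * A k j) (Finset.mem_univ i)]
  simp only [updateRow_self, Function.update_self, zero_mul, zero_add]
  rw [add_comm]
  congr 1
  refine Finset.sum_congr rfl fun k hk => ?_
  rw [updateRow_ne (Finset.ne_of_mem_erase hk), Function.update_of_ne (Finset.ne_of_mem_erase hk)]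

theorem vecMul_updateRow_vecMul {m n : ℕ} (A : Matrix (Fin m) (Fin n) S) (i : Fin m)
    (c v : Fin m → S) :
    v ᵥ* A.updateRow i (c ᵥ* A) = (Function.update v i 0 + v i • c) ᵥ* A := by
  rw [vecMul_updateRow, add_vecMul, smul_vecMul]

theorem RowIndep.updateRow {n : ℕ} {A : Matrix (Fin n) (Fin n) S} (hA : RowIndep A) {i : Fin n}
    {c : Fin n → S} (hc : c i ≠ 0) : RowIndep (A.updateRow i (c ᵥ* A)) := by
  intro v hv
  rw [vecMul_updateRow_vecMul] at hv
  have h := hA _ hv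
  have hi : v i = 0 := by
    have := congrFun h i
    simpa [hc] using this
  ext k
  by_cases hk : k = i
  · rw [hk, hi, Pi.zero_apply]
  · have := congrFun h k
    simpa [hi, hk] using this

/-- The two properties that characterize the Dieudonné determinant on matrices with independent
rows: its behaviour under replacing a row by a linear combination, and its value at `1`. -/
structure IsRowDet {n : ℕ} (F : Matrix (Fin n) (Fin n) S → WithZero (Abelianization Sˣ)) :
    Prop where
  updateRow : ∀ A, RowIndep A → ∀ i (c : Fin n → S), c i ≠ 0 →
    F (A.updateRow i (c ᵥ* A)) = commutatorClassHom S (c i) * F A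
  one : F 1 = 1

theorem RowIndep.submatrix {n : ℕ} {A : Matrix (Fin n) (Fin n) S} (hA : RowIndep A)
    (p : Equiv.Perm (Fin n)) : RowIndep (A.submatrix p id) := by
  intro v hv
  have h : (v ∘ p.symm) ᵥ* A = 0 := by
    rw [← hv]
    ext j
    simp only [vecMul, dotProduct, submatrix_apply, id, Function.comp]
    exact (Equiv.sum_comp p _).symm.trans (by simp)
  have := hA _ h
  ext k
  simpa using congrFun this (p k)

theorem vecMul_single_add {m n : ℕ} (A : Matrix (Fin m) (Fin n) S) (i j : Fin m) (a b : S) :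
    (Pi.single i a + Pi.single j b : Fin m → S) ᵥ* A = a • A i + b • A j := by
  rw [add_vecMul, single_vecMul, single_vecMul]
  rfl

namespace IsRowDet

variable {n : ℕ} {F : Matrix (Fin n) (Fin n) S → WithZero (Abelianization Sˣ)}

theorem add_row (hF : IsRowDet F) {A : Matrix (Fin n) (Fin n) S} (hA : RowIndep A) {i j : Fin n}
    (hij : i ≠ j) (q : S) :
    RowIndep (A.updateRow i (A i + q • A j)) ∧ F (A.updateRow i (A i + q • A j)) = F A := by
  have h := vecMul_single_add A i j 1 q
  have hc : (Pi.single i 1 + Pi.single j q : Fin n → S) i = 1 := by simp [hij]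
  rw [one_smul] at h
  rw [← h]
  refine ⟨hA.updateRow (by rw [hc]; exact one_ne_zero), ?_⟩
  rw [hF.updateRow A hA i _ (by rw [hc]; exact one_ne_zero), hc, map_one, one_mul]

theorem smul_row (hF : IsRowDet F) {A : Matrix (Fin n) (Fin n) S} (hA : RowIndep A) (i : Fin n)
    {q : S} (hq : q ≠ 0) :
    RowIndep (A.updateRow i (q • A i)) ∧
      F (A.updateRow i (q • A i)) = commutatorClassHom S q * F A := by
  have h : (Pi.single i q : Fin n → S) ᵥ* A = q • A i := single_vecMul _ _ _
  have hc : (Pi.single i q : Fin n → S) i = q := by simp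
  rw [← h]
  refine ⟨hA.updateRow (by rwa [hc]), ?_⟩
  rw [hF.updateRow A hA i _ (by rwa [hc]), hc]

theorem swap (hF : IsRowDet F) {A : Matrix (Fin n) (Fin n) S} (hA : RowIndep A) {i j : Fin n}
    (hij : i ≠ j) :
    F (A.submatrix (Equiv.swap i j) id) = commutatorClassHom S (-1) * F A := by
  -- With rows `(a, b)`: `(a + b, b)`, `(a + b, -a)`, `(b, -a)`, `(b, a)`. Only the last move
  -- changes the value.
  obtain ⟨h₁, e₁⟩ := hF.add_row hA hij 1
  obtain ⟨h₂, e₂⟩ := hF.add_row h₁ hij.symm (-1)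
  obtain ⟨h₃, e₃⟩ := hF.add_row h₂ hij 1
  obtain ⟨-, e₄⟩ := hF.smul_row h₃ j (q := -1) (by simp)
  rw [e₃, e₂, e₁] at e₄
  rw [← e₄]
  congr 1
  ext k l
  by_cases hki : k = i
  · subst hki
    simp [updateRow_apply, hij, hij.symm]
  by_cases hkj : k = j
  · subst hkj
    simp [updateRow_apply, hij, hij.symm]
  simp [updateRow_apply, hki, hkj, Equiv.swap_apply_of_ne_of_ne]

theorem perm (hF : IsRowDet F) {A : Matrix (Fin n) (Fin n) S} (hA : RowIndep A)
    (p : Equiv.Perm (Fin n)) :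
    F (A.submatrix p id) = commutatorClassHom S ((Equiv.Perm.sign p : ℤ) : S) * F A := by
  induction p using Equiv.Perm.swap_induction_on' with
  | one => simp
  | mul_swap p i j hij ih =>
    have : A.submatrix (p * Equiv.swap i j) id
        = (A.submatrix p id).submatrix (Equiv.swap i j) id := rfl
    rw [this, hF.swap (hA.submatrix p) hij, ih, ← mul_assoc, ← map_mul]
    congr 2
    simp [Equiv.Perm.sign_swap hij]

theorem diagonal (hF : IsRowDet F) (d : Fin n → Sˣ) :
    RowIndep (Matrix.diagonal fun i => (d i : S)) ∧
      F (Matrix.diagonal fun i => (d i : S))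
        = commutatorClassHom S (List.ofFn fun i => (d i : S)).prod := by
  -- The diagonal is filled in by scaling one row of the identity at a time; the order is immaterial
  -- because the target is commutative.
  have key : ∀ s : Finset (Fin n),
      RowIndep (Matrix.diagonal fun i => if i ∈ s then (d i : S) else 1) ∧
      F (Matrix.diagonal fun i => if i ∈ s then (d i : S) else 1)
        = ∏ i ∈ s, commutatorClassHom S (d i : S) := by
    intro s
    induction s using Finset.induction_on with
    | empty =>
      simp only [Finset.notMem_empty, if_false, Finset.prod_empty, diagonal_one]
      exact ⟨rowIndep_of_isUnit isUnit_one, hF.one⟩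
    | insert a s ha ih =>
      obtain ⟨h, e⟩ := hF.smul_row ih.1 a (d a).ne_zero
      have hM : (Matrix.diagonal fun i => if i ∈ insert a s then (d i : S) else 1)
          = (Matrix.diagonal fun i => if i ∈ s then (d i : S) else 1).updateRow a
            ((d a : S) • (Matrix.diagonal fun i => if i ∈ s then (d i : S) else 1) a) := by
        ext k l
        by_cases hl : k = l
        · subst hl
          by_cases hk : k = a
          · subst hk
            simp [ha]
          · simp [updateRow_apply, hk]
        · by_cases hk : k = a
          · subst hk
            simp [hl]
          · simp [updateRow_apply, hk, hl]
      rw [hM, Finset.prod_insert ha, ← ih.2]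
      exact ⟨h, e⟩
  have := key Finset.univ
  simp only [Finset.mem_univ, if_true] at this
  refine ⟨this.1, this.2.trans ?_⟩
  rw [map_list_prod, List.map_ofFn, List.prod_ofFn]
  rfl

theorem elementary_mul (hF : IsRowDet F) {E : Matrix (Fin n) (Fin n) S}
    (hE : E ∈ elementaryMatrices n S) {A : Matrix (Fin n) (Fin n) S} (hA : RowIndep A) :
    RowIndep (E * A) ∧ F (E * A) = F A := by
  induction hE using Submonoid.closure_induction generalizing A with
  | mem E h =>
    obtain ⟨i, j, q, hij, rfl⟩ := h
    have : (1 + Matrix.single i j q) * A = A.updateRow i (A i + q • A j) := by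
      ext k l
      by_cases hk : k = i
      · subst hk
        simp [add_mul, Matrix.single_mul_apply_same]
      · simp [add_mul, hk, updateRow_apply, Matrix.single_mul_apply_of_ne _ _ _ _ _ hk]
    rw [this]
    exact hF.add_row hA hij q
  | one => simpa using hA
  | mul E E' _ _ ih ih' =>
    rw [mul_assoc]
    exact ⟨(ih (ih' hA).1).1, (ih (ih' hA).1).2.trans (ih' hA).2⟩

theorem eq_of_isDieudonneDet (hF : IsRowDet F) {A : Matrix (Fin n) (Fin n) S} (hA : IsUnit A)
    {c : WithZero (Abelianization Sˣ)} (hc : IsDieudonneDet A c) : c = F A := by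
  obtain ⟨h, -⟩ | ⟨E, hE, p, d, h, rfl⟩ := hc
  · exact absurd hA h
  rw [← (hF.elementary_mul hE (rowIndep_of_isUnit hA)).2, h]
  have hP : p.permMatrix S * Matrix.diagonal (fun i => (d i : S))
      = (Matrix.diagonal fun i => (d i : S)).submatrix p id := by
    rw [Equiv.Perm.permMatrix, PEquiv.toMatrix_toPEquiv_mul]
  rw [hP, hF.perm (hF.diagonal d).1, (hF.diagonal d).2, ← map_mul]
  rfl

end IsRowDet

end DieudonneDet

/-! ### Existence of row determinants, by expansion along the first column. -/

namespace DieudonneDet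

variable {S : Type*} [DivisionRing S] {n : ℕ}

/-- Delete the first column and the row `p 0`, and order the other rows by `p`. -/
def minor (A : Matrix (Fin (n + 1)) (Fin (n + 1)) S) (p : Equiv.Perm (Fin (n + 1))) :
    Matrix (Fin n) (Fin n) S :=
  A.submatrix (fun k => p k.succ) Fin.succ

theorem vecMul_minor (A : Matrix (Fin (n + 1)) (Fin (n + 1)) S) (p : Equiv.Perm (Fin (n + 1)))
    (w : Fin (n + 1) → S) (hw : w (p 0) = 0) :
    (fun k : Fin n => w (p k.succ)) ᵥ* minor A p = fun k => (w ᵥ* A) k.succ := by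
  ext j
  simp only [vecMul, dotProduct, minor, submatrix_apply]
  rw [← Equiv.sum_comp p, Fin.sum_univ_succ, hw, zero_mul, zero_add]

section

variable {A : Matrix (Fin (n + 1)) (Fin (n + 1)) S} {l : Fin (n + 1) → S}
  {p : Equiv.Perm (Fin (n + 1))}

/-- A relation among the rows of the minor, extended by zero at `p 0`, gives a `w` with `w ᵥ* A`
supported in column 0. So `w` is a multiple of `l`, and comparison at `p 0` makes the multiple zero.
-/
theorem RowIndep.minor (hA : RowIndep A) (hl : l ᵥ* A = Pi.single 0 1) (hp : l (p 0) ≠ 0) :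
    RowIndep (minor A p) := by
  intro v hv
  let w : Fin (n + 1) → S := fun k => (Fin.cons 0 v : Fin (n + 1) → S) (p.symm k)
  have h0 : w (p 0) = 0 := by simp [w]
  have hs : ∀ k : Fin n, w (p k.succ) = v k := fun k => by simp [w]
  have h := vecMul_minor A p w h0
  simp only [hs] at h
  have hw : w ᵥ* A = ((w ᵥ* A) 0 • l) ᵥ* A := by
    rw [smul_vecMul, hl]
    ext j
    refine Fin.cases ?_ (fun j => ?_) j
    · simp
    · rw [← congrFun h j]
      simp [show v ᵥ* DieudonneDet.minor A p = 0 from hv]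
  have e := hA.vecMul_injective hw
  have hc : (w ᵥ* A) 0 = 0 := by
    have := congrFun e (p 0)
    rw [h0, Pi.smul_apply, smul_eq_mul] at this
    exact (mul_eq_zero.1 this.symm).resolve_right hp
  ext k
  rw [← hs, e, hc, zero_smul]
  rfl

/-- Subtracting a multiple of `l` from `c` alters `c ᵥ* A` in column 0 only; the multiple is chosen
to kill the coordinate `p 0`, which is absent from the minor. -/
theorem tail_vecMul_eq (hl : l ᵥ* A = Pi.single 0 1) (hp : l (p 0) ≠ 0) (c : Fin (n + 1) → S) :
    (fun k : Fin n => (c ᵥ* A) k.succ)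
      = (fun k : Fin n => c (p k.succ) - c (p 0) * (l (p 0))⁻¹ * l (p k.succ)) ᵥ* minor A p := by
  have h := vecMul_minor A p (c - (c (p 0) * (l (p 0))⁻¹) • l) (by simp [hp])
  rw [sub_vecMul, smul_vecMul, hl] at h
  simpa using h.symm

variable {F : Matrix (Fin n) (Fin n) S → WithZero (Abelianization Sˣ)}

/-- Expansion of the determinant along the first column, with respect to one row. -/
noncomputable def expansion (F : Matrix (Fin n) (Fin n) S → WithZero (Abelianization Sˣ))
    (A : Matrix (Fin (n + 1)) (Fin (n + 1)) S) (l : Fin (n + 1) → S)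
    (p : Equiv.Perm (Fin (n + 1))) : WithZero (Abelianization Sˣ) :=
  commutatorClassHom S ((Equiv.Perm.sign p : ℤ) : S) * (commutatorClassHom S (l (p 0)))⁻¹
    * F (minor A p)

theorem mul_cancel_involution {G : Type*} [CommGroupWithZero G] (s e a b f : G) (he : e * e = 1)
    (hb : b ≠ 0) : s * e * b⁻¹ * (e * (a⁻¹ * b) * f) = s * a⁻¹ * f := by
  calc _ = s * (e * e) * (b⁻¹ * b) * a⁻¹ * f := by ac_rfl
    _ = _ := by rw [he, inv_mul_cancel₀ hb, mul_one, mul_one]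

theorem mul_cancel_involution' {G : Type*} [CommMonoid G] (s e a f : G) (he : e * e = 1) :
    s * e * a * (e * f) = s * a * f := by
  calc _ = s * (e * e) * a * f := by ac_rfl
    _ = _ := by rw [he, mul_one]

/-- Moving the pivot replaces row `m` of the minor by the tail of the old pivot row. By
`tail_vecMul_eq` its coefficient at `m` is `-(l (p 0))⁻¹ * l (p m.succ)`: the sign cancels that of
the swap, and the rest turns one pivot factor into the other. -/
theorem expansion_swap (hF : IsRowDet F) (hA : RowIndep A) (hl : l ᵥ* A = Pi.single 0 1)
    (hp : l (p 0) ≠ 0) {m : Fin n} (hm : l (p m.succ) ≠ 0) :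
    expansion F A l (p * Equiv.swap 0 m.succ) = expansion F A l p := by
  have h := tail_vecMul_eq hl hp (Pi.single (p 0) 1)
  have hM : minor A (p * Equiv.swap 0 m.succ)
      = (minor A p).updateRow m (fun k => ((Pi.single (p 0) 1 : Fin (n + 1) → S) ᵥ* A) k.succ) := by
    ext i j
    by_cases hi : i = m
    · subst hi
      simp [minor]
    · have : Equiv.swap 0 m.succ i.succ = i.succ :=
        Equiv.swap_apply_of_ne_of_ne (Fin.succ_ne_zero _) (by simpa using hi)
      simp [minor, updateRow_apply, hi, this]
  have hc : (Pi.single (p 0) 1 : Fin (n + 1) → S) (p m.succ)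
      - (Pi.single (p 0) 1 : Fin (n + 1) → S) (p 0) * (l (p 0))⁻¹ * l (p m.succ)
      = (-1) * ((l (p 0))⁻¹ * l (p m.succ)) := by
    simp
  have hne : (Pi.single (p 0) 1 : Fin (n + 1) → S) (p m.succ)
      - (Pi.single (p 0) 1 : Fin (n + 1) → S) (p 0) * (l (p 0))⁻¹ * l (p m.succ) ≠ 0 := by
    rw [hc]
    simp [hp, hm]
  rw [expansion, hM, h, hF.updateRow _ (hA.minor hl hp) m _ hne, hc, expansion]
  have hsign : ((Equiv.Perm.sign (p * Equiv.swap 0 m.succ) : ℤ) : S)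
      = ((Equiv.Perm.sign p : ℤ) : S) * (-1) := by
    rw [map_mul, Equiv.Perm.sign_swap (Fin.succ_ne_zero m).symm]
    simp
  have h1 : commutatorClassHom S (-1) * commutatorClassHom S (-1) = 1 := by
    rw [← map_mul]
    simp
  have h2 : commutatorClassHom S (l (p m.succ)) ≠ 0 := (map_ne_zero _).2 hm
  rw [hsign, Equiv.Perm.mul_apply, Equiv.swap_apply_left, map_mul, map_mul, map_mul, map_inv₀]
  exact mul_cancel_involution _ _ _ _ _ h1 h2

/-- The sign of `q` appears twice, in the sign factor and from permuting the rows of the minor, and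
its square is 1. -/
theorem expansion_mul_of_fix (hF : IsRowDet F) (hA : RowIndep A) (hl : l ᵥ* A = Pi.single 0 1)
    (hp : l (p 0) ≠ 0) (q : Equiv.Perm (Fin (n + 1))) (hq : q 0 = 0) :
    expansion F A l (p * q) = expansion F A l p := by
  obtain ⟨⟨a, r⟩, rfl⟩ := Equiv.Perm.decomposeFin.symm.surjective q
  rw [Equiv.Perm.decomposeFin_symm_apply_zero] at hq
  subst hq
  have hM : minor A (p * Equiv.Perm.decomposeFin.symm (0, r)) = (minor A p).submatrix r id := by
    ext i j
    simp [minor]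
  rw [expansion, expansion, hM, hF.perm (hA.minor hl hp), map_mul,
    Equiv.Perm.decomposeFin.symm_sign, if_pos rfl, one_mul, Equiv.Perm.mul_apply,
    Equiv.Perm.decomposeFin_symm_apply_zero]
  have h1 : commutatorClassHom S ((Equiv.Perm.sign r : ℤ) : S)
      * commutatorClassHom S ((Equiv.Perm.sign r : ℤ) : S) = 1 := by
    rw [← map_mul, ← Int.cast_mul, ← Units.val_mul, Int.units_mul_self]
    simp
  rw [Units.val_mul, Int.cast_mul, map_mul]
  exact mul_cancel_involution' _ _ _ _ h1

/-- Up to a permutation fixing 0, `p'` is either `p` or `p` followed by one change of pivot. -/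
theorem expansion_eq (hF : IsRowDet F) (hA : RowIndep A) (hl : l ᵥ* A = Pi.single 0 1)
    (hp : l (p 0) ≠ 0) {p' : Equiv.Perm (Fin (n + 1))} (hp' : l (p' 0) ≠ 0) :
    expansion F A l p' = expansion F A l p := by
  by_cases h : p.symm (p' 0) = 0
  · have := expansion_mul_of_fix hF hA hl hp (p⁻¹ * p') h
    rwa [mul_inv_cancel_left] at this
  · obtain ⟨m, hm⟩ := Fin.exists_succ_eq.2 h
    have hm' : p m.succ = p' 0 := by rw [hm, Equiv.apply_symm_apply]
    rw [← expansion_swap hF hA hl hp (m := m) (by rwa [hm'])]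
    have h0 : (p * Equiv.swap 0 m.succ) 0 = p' 0 := by simp [hm']
    have := expansion_mul_of_fix hF hA hl (p := p * Equiv.swap 0 m.succ) (by rwa [h0])
      ((p * Equiv.swap 0 m.succ)⁻¹ * p')
      (by rw [Equiv.Perm.mul_apply, ← h0, Equiv.Perm.inv_def, Equiv.symm_apply_apply])
    rwa [mul_inv_cancel_left] at this

open Classical in
/-- The determinant in size `n + 1` from the one in size `n`. -/
noncomputable def nextDet (F : Matrix (Fin n) (Fin n) S → WithZero (Abelianization Sˣ))
    (A : Matrix (Fin (n + 1)) (Fin (n + 1)) S) : WithZero (Abelianization Sˣ) :=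
  if h : ∃ x : (Fin (n + 1) → S) × Equiv.Perm (Fin (n + 1)),
      x.1 ᵥ* A = Pi.single 0 1 ∧ x.1 (x.2 0) ≠ 0 then
    expansion F A h.choose.1 h.choose.2
  else 0

theorem nextDet_eq (hF : IsRowDet F) (hA : RowIndep A) (hl : l ᵥ* A = Pi.single 0 1)
    (hp : l (p 0) ≠ 0) : nextDet F A = expansion F A l p := by
  have h : ∃ x : (Fin (n + 1) → S) × Equiv.Perm (Fin (n + 1)),
      x.1 ᵥ* A = Pi.single 0 1 ∧ x.1 (x.2 0) ≠ 0 := ⟨(l, p), hl, hp⟩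
  have e : h.choose.1 = l := hA.vecMul_injective (h.choose_spec.1.trans hl.symm)
  have hne := h.choose_spec.2
  rw [nextDet, dif_pos h]
  rw [e] at hne ⊢
  exact expansion_eq hF hA hl hp hne

theorem IsRowDet.nextDet_updateRow (hF : IsRowDet F) (hA : RowIndep A) (i : Fin (n + 1))
    (c : Fin (n + 1) → S) (hc : c i ≠ 0) :
    nextDet F (A.updateRow i (c ᵥ* A)) = commutatorClassHom S (c i) * nextDet F A := by
  obtain ⟨l, hl⟩ := hA.exists_vecMul_eq (Pi.single 0 1)
  have hA' := hA.updateRow hc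
  -- If `l i = 0`, the vector `l` survives the update and the changed row lies inside the minor.
  -- Otherwise row `i` can serve as pivot, so that the minor is unchanged and only `l` moves.
  by_cases hi : l i = 0
  · obtain ⟨k, hk⟩ : ∃ k, l k ≠ 0 := by
      by_contra! h
      rw [show l = 0 from funext h, zero_vecMul] at hl
      simpa using congrFun hl 0
    have hl' : l ᵥ* A.updateRow i (c ᵥ* A) = Pi.single 0 1 := by
      rw [vecMul_updateRow_vecMul, hi, zero_smul, add_zero, ← hi, Function.update_eq_self, hl]
    have hp : l (Equiv.swap 0 k 0) ≠ 0 := by rwa [Equiv.swap_apply_left]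
    have hik : i ≠ k := by
      rintro rfl
      exact hk hi
    obtain ⟨m, hm⟩ : ∃ m : Fin n, Equiv.swap 0 k m.succ = i := by
      obtain ⟨m, hm⟩ := Fin.exists_succ_eq (x := Equiv.swap 0 k i).2 (by
        exact fun h => hik ((Equiv.swap 0 k).injective (h.trans (Equiv.swap_apply_right 0 k).symm)))
      exact ⟨m, by rw [hm, Equiv.swap_apply_self]⟩
    have hM : minor (A.updateRow i (c ᵥ* A)) (Equiv.swap 0 k)
        = (minor A (Equiv.swap 0 k)).updateRow m (fun j => (c ᵥ* A) j.succ) := by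
      ext r s
      by_cases hr : r = m
      · subst hr
        simp [minor, hm]
      · have : Equiv.swap 0 k r.succ ≠ i := by
          rw [← hm]
          simpa using hr
        simp [minor, updateRow_apply, this, hr]
    -- The correction term from the pivot row vanishes because `l i = 0`.
    have hcm : c (Equiv.swap 0 k m.succ) - c (Equiv.swap 0 k 0) * (l (Equiv.swap 0 k 0))⁻¹
        * l (Equiv.swap 0 k m.succ) = c i := by
      rw [hm, hi, mul_zero, sub_zero]
    rw [nextDet_eq hF hA' hl' hp, nextDet_eq hF hA hl hp, expansion, expansion, hM,
      tail_vecMul_eq hl hp, hF.updateRow _ (hA.minor hl hp) m _ (by rwa [hcm]), hcm]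
    ac_rfl
  -- The solution of `Function.update l' i 0 + l' i • c = l`; coordinate `i` forces `l' i = l i * (c
  -- i)⁻¹`.
  · let l' : Fin (n + 1) → S := l - (l i * (c i)⁻¹) • c + Pi.single i (l i * (c i)⁻¹)
    have hi' : l' i = l i * (c i)⁻¹ := by simp [l', hc]
    have hl' : l' ᵥ* A.updateRow i (c ᵥ* A) = Pi.single 0 1 := by
      rw [vecMul_updateRow_vecMul, hi', ← hl]
      congr 1
      ext k
      by_cases hk : k = i
      · subst hk
        simp [hc]
      · simp [l', hk]
    have hp : l (Equiv.swap 0 i 0) ≠ 0 := by rwa [Equiv.swap_apply_left]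
    have hp' : l' (Equiv.swap 0 i 0) ≠ 0 := by
      rw [Equiv.swap_apply_left, hi']
      exact mul_ne_zero hi (inv_ne_zero hc)
    have hM : minor (A.updateRow i (c ᵥ* A)) (Equiv.swap 0 i) = minor A (Equiv.swap 0 i) := by
      ext r s
      have : Equiv.swap 0 i r.succ ≠ i := by
        exact fun h => Fin.succ_ne_zero r
          ((Equiv.swap 0 i).injective (h.trans (Equiv.swap_apply_left 0 i).symm))
      simp [minor, updateRow_apply, this]
    rw [nextDet_eq hF hA' hl' hp', nextDet_eq hF hA hl hp, expansion, expansion, hM,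
      Equiv.swap_apply_left, hi', map_mul, map_inv₀, mul_inv, inv_inv]
    ac_rfl

theorem IsRowDet.nextDet_one (hF : IsRowDet F) :
    nextDet F (1 : Matrix (Fin (n + 1)) (Fin (n + 1)) S) = 1 := by
  rw [nextDet_eq hF (rowIndep_of_isUnit isUnit_one) (l := Pi.single 0 1) (p := 1)
    (vecMul_one _) (by simp), expansion]
  have : minor (1 : Matrix (Fin (n + 1)) (Fin (n + 1)) S) 1 = 1 := by
    ext i j
    simp [minor, one_apply]
  rw [this, hF.one]
  simp

end

theorem exists_isRowDet (S : Type*) [DivisionRing S] (n : ℕ) :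
    ∃ F : Matrix (Fin n) (Fin n) S → WithZero (Abelianization Sˣ), IsRowDet F := by
  induction n with
  | zero => exact ⟨fun _ => 1, ⟨fun _ _ i => i.elim0, rfl⟩⟩
  | succ n ih =>
    obtain ⟨F, hF⟩ := ih
    exact ⟨nextDet F, ⟨fun _ hA i c hc => hF.nextDet_updateRow hA i c hc, hF.nextDet_one⟩⟩

theorem isDieudonneDet_unique {A : Matrix (Fin n) (Fin n) S} (hA : IsUnit A)
    {c c' : WithZero (Abelianization Sˣ)} (hc : IsDieudonneDet A c) (hc' : IsDieudonneDet A c') :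
    c = c' := by
  obtain ⟨F, hF⟩ := exists_isRowDet S n
  rw [hF.eq_of_isDieudonneDet hA hc, hF.eq_of_isDieudonneDet hA hc']

end DieudonneDet

/-! ### Reduction to diagonal form over a ring with left division. -/

namespace DieudonneDet

section

variable {S : Type*} [DivisionRing S] {n : ℕ}

/-- The summands share column `k` and `c k = 0`, so their products vanish and the sum factors into
elementary matrices. -/
theorem one_add_column_mem (k : Fin n) (c : Fin n → S) (hc : c k = 0) (s : Finset (Fin n)) :
    1 + ∑ i ∈ s, Matrix.single i k (c i) ∈ elementaryMatrices n S := by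
  induction s using Finset.induction_on with
  | empty => simp
  | insert a s ha ih =>
    by_cases hak : a = k
    · rw [Finset.sum_insert ha, hak, hc, Matrix.single_zero, zero_add]
      exact ih
    · have h0 : Matrix.single a k (c a) * ∑ i ∈ s, Matrix.single i k (c i) = 0 := by
        rw [Finset.mul_sum]
        refine Finset.sum_eq_zero fun i _ => ?_
        by_cases hi : k = i
        · rw [← hi, hc, Matrix.single_zero, mul_zero]
        · exact Matrix.single_mul_single_of_ne _ _ _ _ hi _
      have : 1 + ∑ i ∈ insert a s, Matrix.single i k (c i)
          = (1 + Matrix.single a k (c a)) * (1 + ∑ i ∈ s, Matrix.single i k (c i)) := by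
        rw [Finset.sum_insert ha, mul_add, mul_one, add_mul, one_mul, h0, add_zero, add_assoc]
      rw [this]
      exact mul_mem (Submonoid.subset_closure ⟨a, k, c a, hak, rfl⟩) ih

variable {R : Type*} [Ring R]

/-- Elementary row operations over `S` take `M` to `N`. -/
def RowReach (f : R →+* S) (M N : Matrix (Fin n) (Fin n) R) : Prop :=
  ∃ E ∈ elementaryMatrices n S, E * M.map f = N.map f

/-- Add `c i` times the row `k` to each row `i`. -/
def addRow (N : Matrix (Fin n) (Fin n) R) (k : Fin n) (c : Fin n → R) :
    Matrix (Fin n) (Fin n) R :=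
  Matrix.of fun i j => N i j + c i * N k j

theorem RowReach.refl (f : R →+* S) (M : Matrix (Fin n) (Fin n) R) : RowReach f M M :=
  ⟨1, one_mem _, one_mul _⟩

theorem RowReach.addRow {f : R →+* S} {M N : Matrix (Fin n) (Fin n) R} (h : RowReach f M N)
    {k : Fin n} {c : Fin n → R} (hc : c k = 0) : RowReach f M (addRow N k c) := by
  obtain ⟨E, hE, e⟩ := h
  refine ⟨_, mul_mem (one_add_column_mem k (fun i => f (c i)) (by simp [hc]) Finset.univ) hE, ?_⟩
  rw [mul_assoc, e, add_mul, one_mul, Finset.sum_mul]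
  ext i j
  rw [Matrix.add_apply, Matrix.sum_apply, Finset.sum_eq_single i]
  · simp [DieudonneDet.addRow]
  · intro b _ hb
    exact Matrix.single_mul_apply_of_ne _ _ _ _ _ hb.symm _
  · simp

theorem RowReach.rowIndep {f : R →+* S} {M N : Matrix (Fin n) (Fin n) R} (h : RowReach f M N)
    (hM : RowIndep (M.map f)) : RowIndep (N.map f) := by
  obtain ⟨E, hE, e⟩ := h
  obtain ⟨F, hF⟩ := exists_isRowDet S n
  rw [← e]
  exact (hF.elementary_mul hE hM).1

/-- The first `k` columns vanish below the diagonal. -/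
def TriangularTo (k : ℕ) (N : Matrix (Fin n) (Fin n) R) : Prop :=
  ∀ i j : Fin n, (j : ℕ) < k → j < i → N i j = 0

theorem TriangularTo.addRow {k : ℕ} {N : Matrix (Fin n) (Fin n) R} (h : TriangularTo k N)
    {r : Fin n} (hr : k ≤ r) (c : Fin n → R) : TriangularTo k (addRow N r c) := by
  intro i j hj hij
  have hjr : j < r := Fin.lt_def.2 (by omega)
  simp [DieudonneDet.addRow, h i j hj hij, h r j hj hjr]

/-- Euclid's algorithm in column `k`, by induction on the size of the pivot: a nonzero remainder at
or below row `k` becomes the next, smaller pivot. -/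
theorem exists_clear_column (f : R →+* S) (size : R → ℕ)
    (hdiv : ∀ a b : R, b ≠ 0 → ∃ q, size (a + q * b) < size b)
    (M : Matrix (Fin n) (Fin n) R) (k : Fin n) (s : ℕ) (N : Matrix (Fin n) (Fin n) R)
    (hN : RowReach f M N) (hk : TriangularTo k N) (i : Fin n) (hi : k ≤ i) (h0 : N i k ≠ 0)
    (hs : size (N i k) = s) :
    ∃ N', RowReach f M N' ∧ TriangularTo k N' ∧ ∀ j, k < j → N' j k = 0 := by
  induction s using Nat.strong_induction_on generalizing N i with
  | _ s ih =>
    choose q hq using fun j => hdiv (N j k) (N i k) h0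
    let c : Fin n → R := fun j => if j = i then 0 else q j
    have hN₁ : RowReach f M (addRow N i c) := hN.addRow (by simp [c])
    have hk₁ : TriangularTo k (addRow N i c) := hk.addRow hi c
    have hii : addRow N i c i k = N i k := by simp [addRow, c]
    by_cases hall : ∀ j, k ≤ j → j ≠ i → addRow N i c j k = 0
    · by_cases hik : i = k
      · exact ⟨_, hN₁, hk₁, fun j hj => hall j hj.le (by rw [hik]; exact hj.ne')⟩
      · have hki := hall k le_rfl (Ne.symm hik)
        -- Row `k` has a zero in this column, so adding row `i` to it and then subtracting row `k`
        -- from row `i` moves the pivot into place. No swap is used, hence the permutation in the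
        -- final reduction is trivial.
        have hN₂ := (hN₁.addRow (k := i) (c := Pi.single k 1) (by simp [hik])).addRow
          (k := k) (c := Pi.single i (-1)) (by simp [Ne.symm hik])
        refine ⟨_, hN₂, (hk₁.addRow hi _).addRow le_rfl _, fun j hj => ?_⟩
        by_cases hji : j = i
        · subst hji
          rw [addRow, of_apply, addRow, of_apply, of_apply, hki]
          simp [hj.ne']
        · rw [addRow, of_apply, addRow, of_apply, hall j hj.le hji]
          simp [hji, hj.ne']
    · push Not at hall
      obtain ⟨j, hj, hji, hne⟩ := hall
      refine ih _ ?_ _ hN₁ hk₁ j hj hne rfl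
      rw [← hs]
      simpa [addRow, c, hji] using hq j

theorem exists_triangular (f : R →+* S) (size : R → ℕ)
    (hdiv : ∀ a b : R, b ≠ 0 → ∃ q, size (a + q * b) < size b)
    (M : Matrix (Fin n) (Fin n) R) :
    ∃ N, RowReach f M N ∧ ∀ i j, j < i → N i j = 0 := by
  have key : ∀ k ≤ n, ∃ N, RowReach f M N ∧ TriangularTo k N := by
    intro k
    induction k with
    | zero => exact fun _ => ⟨M, .refl f M, fun i j hj => absurd hj (Nat.not_lt_zero _)⟩
    | succ k ih =>
      intro hk
      obtain ⟨N, hN, ht⟩ := ih (by omega)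
      let k' : Fin n := ⟨k, hk⟩
      obtain ⟨N', hN', ht', h0⟩ :
          ∃ N', RowReach f M N' ∧ TriangularTo k N' ∧ ∀ j, k' < j → N' j k' = 0 := by
        by_cases hall : ∀ j, k' < j → N j k' = 0
        · exact ⟨N, hN, ht, hall⟩
        · push Not at hall
          obtain ⟨i, hi, hne⟩ := hall
          exact exists_clear_column f size hdiv M k' _ N hN ht i hi.le hne rfl
      refine ⟨N', hN', fun i j hj hij => ?_⟩
      rcases Nat.lt_succ_iff_lt_or_eq.1 hj with hj | hj
      · exact ht' i j hj hij
      · obtain rfl : j = k' := Fin.ext hj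
        exact h0 i hij
  obtain ⟨N, hN, ht⟩ := key n le_rfl
  exact ⟨N, hN, fun i j hij => ht i j j.2 hij⟩

/-- Solving `v ᵥ* A = Pi.single i 1` for each `i` gives a left inverse of `A`. -/
theorem RowIndep.eq_zero_of_mulVec {A : Matrix (Fin n) (Fin n) S} (hA : RowIndep A)
    {v : Fin n → S} (hv : A *ᵥ v = 0) : v = 0 := by
  choose B hB using fun i => hA.exists_vecMul_eq (Pi.single i 1)
  have h : Matrix.of B * A = 1 := by
    ext i j
    exact (congrFun (hB i) j).trans (by rw [Matrix.one_apply, Pi.single_apply]; simp [eq_comm])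
  rw [← one_mulVec v, ← h, ← mulVec_mulVec, hv, mulVec_zero]

/-- Columns are cleared from left to right. The invariant retains the diagonal of `T`, so entries
coming from the subring stay there although the multipliers involve inverses. -/
theorem exists_diagonal {T : Matrix (Fin n) (Fin n) S} (hT : RowIndep T)
    (ht : ∀ i j, j < i → T i j = 0) :
    (∀ i, T i i ≠ 0) ∧ ∃ E ∈ elementaryMatrices n S, E * T = diagonal fun i => T i i := by
  have hT' : RowIndep (T.map (RingHom.id S)) := hT
  have key : ∀ k ≤ n, ∃ N, RowReach (RingHom.id S) T N ∧ (∀ i j, j < i → N i j = 0) ∧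
      (∀ i, N i i = T i i) ∧
      ∀ j : Fin n, (j : ℕ) < k → T j j ≠ 0 ∧ ∀ i, i ≠ j → N i j = 0 := by
    intro k
    induction k with
    | zero => exact fun _ => ⟨T, .refl _ T, ht, fun _ => rfl, fun j hj => absurd hj (by omega)⟩
    | succ k ih =>
      intro hk
      obtain ⟨N, hN, hu, hd, hc⟩ := ih (by omega)
      let k' : Fin n := ⟨k, hk⟩
      have hI : RowIndep N := hN.rowIndep hT'
      have hne : T k' k' ≠ 0 := by
        intro h0
        -- If the diagonal entry vanished, column `k'` would be a right combination of the earlier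
        -- columns, already diagonal with nonzero entries. The vector `v` records this relation.
        let v : Fin n → S := fun j => if j < k' then -((N j j)⁻¹ * N j k') else
          if j = k' then 1 else 0
        have hv : N *ᵥ v = 0 := by
          ext i
          rw [mulVec, dotProduct, Pi.zero_apply]
          by_cases hi : i < k'
          · rw [Finset.sum_eq_add i k' hi.ne]
            · have := (hc i hi).1
              rw [← hd] at this
              simp [v, hi, this]
            · rintro j - ⟨hji, hjk⟩
              by_cases hj : j < k'
              · rw [(hc j hj).2 i (Ne.symm hji), zero_mul]
              · simp [v, hj, hjk]
            · simp
            · simp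
          · refine Finset.sum_eq_zero fun j _ => ?_
            by_cases hj : j < k'
            · rw [hu i j (lt_of_lt_of_le hj (not_lt.1 hi)), zero_mul]
            · by_cases hjk : j = k'
              · subst hjk
                rcases (not_lt.1 hi).eq_or_lt with h | h
                · rw [← h, hd, h0, zero_mul]
                · rw [hu _ _ h, zero_mul]
              · simp [v, hj, hjk]
        have := congrFun (hI.eq_zero_of_mulVec hv) k'
        simp [v] at this
      have hne' : N k' k' ≠ 0 := by rwa [hd]
      let c : Fin n → S := fun i => if i = k' then 0 else -(N i k' * (N k' k')⁻¹)
      have hck : c k' = 0 := by simp [c]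
      have hcu : ∀ i, k' < i → c i = 0 := fun i hi => by simp [c, hu i k' hi]
      refine ⟨addRow N k' c, hN.addRow hck, fun i j hij => ?_, fun i => ?_, fun j hj => ?_⟩
      · rw [addRow, of_apply, hu i j hij, zero_add]
        by_cases hi : k' < i
        · rw [hcu i hi, zero_mul]
        · rw [hu k' j (lt_of_lt_of_le hij (not_lt.1 hi)), mul_zero]
      · rw [addRow, of_apply, ← hd]
        rcases lt_trichotomy i k' with h | h | h
        · rw [hu k' i h, mul_zero, add_zero]
        · rw [h, hck, zero_mul, add_zero]
        · rw [hcu i h, zero_mul, add_zero]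
      · rcases Nat.lt_succ_iff_lt_or_eq.1 hj with hj | hj
        · refine ⟨(hc j hj).1, fun i hi => ?_⟩
          have : k' ≠ j := fun h => by simp [← h, k'] at hj
          rw [addRow, of_apply, (hc j hj).2 i hi, (hc j hj).2 k' this, mul_zero, add_zero]
        · obtain rfl : j = k' := Fin.ext hj
          refine ⟨hne, fun i hi => ?_⟩
          simp [addRow, c, hi, mul_assoc, hne']
  obtain ⟨N, ⟨E, hE, e⟩, hu, hd, hc⟩ := key n le_rfl
  refine ⟨fun i => (hc i i.2).1, E, hE, ?_⟩
  refine (show E * T = N from e).trans ?_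
  ext i j
  by_cases h : i = j
  · subst h
    rw [diagonal_apply_eq, hd]
  · rw [diagonal_apply_ne _ h, (hc j j.2).2 i h]

/-- Over a ring with a left division algorithm, the Dieudonné determinant of a matrix is the class
of an element of the ring. -/
theorem exists_isDieudonneDet (f : R →+* S) (size : R → ℕ)
    (hdiv : ∀ a b : R, b ≠ 0 → ∃ q, size (a + q * b) < size b)
    {M : Matrix (Fin n) (Fin n) R} (hM : IsUnit (M.map f)) :
    ∃ a : R, f a ≠ 0 ∧ IsDieudonneDet (M.map f) (commutatorClass (f a)) := by
  obtain ⟨N, hN, ht⟩ := exists_triangular f size hdiv M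
  obtain ⟨hd, E', hE', e'⟩ := exists_diagonal (hN.rowIndep (rowIndep_of_isUnit hM))
    (fun i j hij => by rw [map_apply, ht i j hij, map_zero])
  obtain ⟨E, hE, e⟩ := hN
  have hprod : f (List.ofFn fun i => N i i).prod = (List.ofFn fun i => f (N i i)).prod := by
    rw [map_list_prod, List.map_ofFn]
    rfl
  refine ⟨(List.ofFn fun i => N i i).prod, ?_, Or.inr ⟨E' * E, mul_mem hE' hE, 1,
    fun i => Units.mk0 _ (hd i), ?_, ?_⟩⟩
  · rw [hprod]
    refine List.prod_ne_zero fun h => ?_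
    obtain ⟨i, hi⟩ := (List.mem_ofFn' _ _).1 h
    exact hd i hi
  · rw [mul_assoc, e, e', Equiv.Perm.permMatrix, PEquiv.toMatrix_toPEquiv_mul]
    rfl
  · rw [hprod]
    simp

end

/-! ### Application to Ore polynomials. -/

theorem dieudonneDet_eq {S : Type*} [DivisionRing S] {n : ℕ} {M : Matrix (Fin n) (Fin n) S}
    (hM : IsUnit M) {c : WithZero (Abelianization Sˣ)} (hc : IsDieudonneDet M c) :
    dieudonneDet M = c := by
  have h : ∃! c, IsDieudonneDet M c := ⟨c, hc, fun _ h => isDieudonneDet_unique hM h hc⟩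
  rw [dieudonneDet, dif_pos h]
  exact isDieudonneDet_unique hM h.choose_spec.1 hc

theorem commutatorClass_eq_iff {S : Type*} [DivisionRing S] {a b : S} (ha : a ≠ 0) :
    commutatorClass a = commutatorClass b ↔ ∃ u ∈ commutator Sˣ, b = (u : S) * a := by
  by_cases hb : b = 0
  · subst hb
    simp [commutatorClass, ha]
  · rw [commutatorClass, commutatorClass, dif_neg ha, dif_neg hb, WithZero.coe_inj]
    constructor
    · intro h
      refine ⟨Units.mk0 b hb * (Units.mk0 a ha)⁻¹, ?_, by simp [ha]⟩
      rw [← Abelianization.ker_of, MonoidHom.mem_ker, map_mul, map_inv, h, mul_inv_cancel]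
    · rintro ⟨u, hu, h⟩
      rw [← Abelianization.ker_of, MonoidHom.mem_ker] at hu
      have : Units.mk0 b hb = u * Units.mk0 a ha := Units.ext h
      rw [this, map_mul, hu, one_mul]

/-- The size is the degree plus one, and 0 for the zero polynomial, so that a zero remainder is
strictly smaller even than a nonzero constant. -/
theorem skewPolynomial_div {K : Type*} [DivisionRing K] [MulSemiringAction (Multiplicative ℕ) K]
    (a b : SkewPolynomial K) (hb : b ≠ 0) :
    ∃ q, (a + q * b).support.sup (· + 1) < b.support.sup (· + 1) := by
  obtain ⟨m, hm, hm'⟩ := SkewPolynomial.exists_lead hb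
  obtain ⟨q, r, h, hr⟩ := SkewPolynomial.exists_div hm hm' (a.support.sup (· + 1)) a fun k hk => by
    by_contra hne
    have := Finset.le_sup (f := (· + 1)) (SkewPolynomial.mem_support_iff.2 hne)
    exact absurd this (by omega)
  refine ⟨-q, ?_⟩
  rw [h, neg_mul, add_comm (q * b), add_assoc, add_neg_cancel, add_zero]
  have h1 : m + 1 ≤ b.support.sup (· + 1) :=
    Finset.le_sup (f := (· + 1)) (SkewPolynomial.mem_support_iff.2 hm)
  refine lt_of_le_of_lt (Finset.sup_le fun k hk => ?_) h1
  by_contra hlt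
  exact SkewPolynomial.mem_support_iff.1 hk (hr k (by omega))

end DieudonneDet

theorem mainTheorem2 {A : Type*} [DivisionRing A] (σ : A ≃+* A) (n : ℕ)
    (M : Matrix (Fin n) (Fin n) (OrePoly σ))
    (hM : IsUnit (M.map (OrePoly.toFrac σ))) :
    ∃ f : OrePoly σ, f ≠ 0 ∧
      dieudonneDet (M.map (OrePoly.toFrac σ)) = commutatorClass (OrePoly.toFrac σ f) ∧
      ∀ g : OrePoly σ,
        dieudonneDet (M.map (OrePoly.toFrac σ)) = commutatorClass (OrePoly.toFrac σ g) ↔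
          ∃ u ∈ commutator (OreFrac σ)ˣ,
            OrePoly.toFrac σ g = (u : OreFrac σ) * OrePoly.toFrac σ f := by
  obtain ⟨f, hf, hdet⟩ := DieudonneDet.exists_isDieudonneDet (OrePoly.toFrac σ)
    (fun a => a.support.sup (· + 1)) (fun a b hb => DieudonneDet.skewPolynomial_div a b hb) hM
  have e := DieudonneDet.dieudonneDet_eq hM hdet
  refine ⟨f, fun h => hf (by rw [h, map_zero]), e, fun g => ?_⟩
  rw [e]
  exact DieudonneDet.commutatorClass_eq_iff hf
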